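/- Let $K$ be an algebraically closed field, let $t$ be a natural number and let $d=(d_1,\dots,d_t)$ be a vector of positive integers. Let $\mathcal R(d)$ be the affine space of all tuples $A=(A_{1,2},A_{2,3},\dots,A_{t-1,t})$, where $A_{l,l+1}$ is a $d_l\times d_{l+1}$ matrix over $K$, with its Zariski topology. For $1\le i<j\le t$ put $A_{(i,j)}=A_{i,i+1}A_{i+1,i+2}\cdots A_{j-1,j}$ and $r_{i,j}=\min\{d_l\mid i\le l\le j\}$, and let $$Y_{i,j}=\{A\in\mathcal R(d)\mid \operatorname{rk}A_{(i,j)}\le r_{i,j}-1\}.$$ Let $$J(d)=\{(i,j)\mid 1\le i<j\le t \text{ and } d_l>\max\{d_i,d_j\}\text{ for all } i<l<j\}.$$ Then for all $1\le i<j\le t$ the variety $Y_{i,j}$ is irreducible if and only if $(i,j)\in J(d)$. Moreover, if $(i,j)\notin J(d)$, then $Y_{i,j}$ has at least two irreducible components, neither of which contains the other. -/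

import Mathlib

namespace TypeAQuiver

/-- The representation space of the linearly oriented quiver of type `A` with vertices `1, …, t`
and arrows `l + 1 ⟶ l` (`1 ≤ l < t`), for the dimension vector `(d 1, …, d t)` (all other values of
`d` are irrelevant). A point is a family of matrices `A l = A_{l,l+1}`, where `A l` represents a
linear map from `K ^ d (l + 1)` to `K ^ d l`. -/
def RepSpace (K : Type*) (t : ℕ) (d : ℕ → ℕ) : Type _ :=
  (l : Finset.Ico 1 t) → Matrix (Fin (d l)) (Fin (d (l + 1))) K

/-- The index set of the coordinates (matrix entries) of the representation space. -/
abbrev Coord (t : ℕ) (d : ℕ → ℕ) : Type :=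
  (l : Finset.Ico 1 t) × (Fin (d l) × Fin (d (l + 1)))

section

variable {K : Type*} [Field K] {t : ℕ} {d : ℕ → ℕ}

/-- The coordinates of a representation: all its matrix entries. -/
def coords (A : RepSpace K t d) : Coord t d → K :=
  fun c => A c.1 c.2.1 c.2.2

/-- The set of common zeros, in the representation space, of a set of polynomials in the
matrix entries. -/
def zeroSet (P : Set (MvPolynomial (Coord t d) K)) : Set (RepSpace K t d) :=
  {A | ∀ p ∈ P, MvPolynomial.eval (coords A) p = 0}

/-- The Zariski topology on the affine space of representations: the closed sets are the sets of
common zeros of sets of polynomials in the matrix entries. -/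
instance zariskiTopology : TopologicalSpace (RepSpace K t d) :=
  TopologicalSpace.ofClosed {S | ∃ P : Set (MvPolynomial (Coord t d) K), S = zeroSet P}
    ⟨{1}, by ext A; simp [zeroSet]⟩
    (by
      intro 𝒮 h𝒮
      refine ⟨{p | ∃ P : Set (MvPolynomial (Coord t d) K), zeroSet P ∈ 𝒮 ∧ p ∈ P}, ?_⟩
      ext A
      constructor
      · rintro hA p ⟨P, hP, hp⟩
        exact hA _ hP p hp
      · intro hA S hS
        obtain ⟨P, rfl⟩ := h𝒮 hS
        exact fun p hp => hA p ⟨P, hS, hp⟩)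
    (by
      rintro _ ⟨P, rfl⟩ _ ⟨Q, rfl⟩
      refine ⟨{r | ∃ p ∈ P, ∃ q ∈ Q, r = p * q}, ?_⟩
      ext A
      constructor
      · rintro (hA | hA) _ ⟨p, hp, q, hq, rfl⟩
        · simp [hA p hp]
        · simp [hA q hq]
      · intro hA
        by_contra hcon
        simp only [Set.mem_union, not_or, zeroSet, Set.mem_ofPred_eq, not_forall] at hcon
        obtain ⟨⟨p, hp, hpA⟩, q, hq, hqA⟩ := hcon
        have := hA _ ⟨p, hp, q, hq, rfl⟩
        simp_all)

theorem isClosed_iff_zeroSet (S : Set (RepSpace K t d)) :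
    IsClosed S ↔ ∃ P : Set (MvPolynomial (Coord t d) K), S = zeroSet P := by
  rw [← isOpen_compl_iff]
  change Sᶜᶜ ∈ {S | ∃ P : Set (MvPolynomial (Coord t d) K), S = zeroSet P} ↔ _
  rw [compl_compl]
  exact Iff.rfl

/-- The matrix `A_{l,l+1}` of a representation; the value is the zero matrix for indices `l` that
are not arrows of the quiver. -/
def arrow (A : RepSpace K t d) (l : ℕ) : Matrix (Fin (d l)) (Fin (d (l + 1))) K :=
  if h : l ∈ Finset.Ico 1 t then A ⟨l, h⟩ else 0

/-- The product `A_{i,i+1} A_{i+1,i+2} ⋯ A_{i+m-1,i+m}` of `m` consecutive matrices of a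
representation. -/
def pathProd (A : RepSpace K t d) (i : ℕ) : (m : ℕ) → Matrix (Fin (d i)) (Fin (d (i + m))) K
  | 0 => 1
  | m + 1 => pathProd A i m * arrow A (i + m)

/-- The rank of `A_{(i,j)} = A_{i,i+1} A_{i+1,i+2} ⋯ A_{j-1,j}`, for `1 ≤ i ≤ j ≤ t`. -/
noncomputable def pathRank (A : RepSpace K t d) (i j : ℕ) : ℕ :=
  (pathProd A i (j - i)).rank

end

/-- `r_{i,j} = min {d_l | i ≤ l ≤ j}`, for `i ≤ j`. -/
noncomputable def genericRank (d : ℕ → ℕ) (i j : ℕ) : ℕ :=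
  sInf (d '' Set.Icc i j)

/-- The rank variety `Y_{i,j}`: the representations `A` with `rk A_{(i,j)} ≤ r_{i,j} - 1`
(an inequality of integers, that is, `rk A_{(i,j)} < r_{i,j}`). -/
def rankVariety (K : Type*) [Field K] (t : ℕ) (d : ℕ → ℕ) (i j : ℕ) : Set (RepSpace K t d) :=
  {A | pathRank A i j < genericRank d i j}

/-- The set `J(d)` of pairs `(i,j)` with `1 ≤ i < j ≤ t` such that `d_l > max {d_i, d_j}` for all
`i < l < j`. -/
def J (t : ℕ) (d : ℕ → ℕ) : Set (ℕ × ℕ) :=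
  {p | 1 ≤ p.1 ∧ p.1 < p.2 ∧ p.2 ≤ t ∧ ∀ l, p.1 < l → l < p.2 → max (d p.1) (d p.2) < d l}

end TypeAQuiver

/-! Reducibility: if `(i,j)` is not in `J(d)`, pick an interior vertex `l` of smallest dimension and
factor `A_{(i,j)} = A_{(i,l)} A_{(l,j)}`. When `d_l ≤ d_i`, either `rk A_{(i,l)} < d_l`, or the left
factor is injective and `rk A_{(l,j)} < min(d_l, d_j)`; the case `d_l ≤ d_j` is symmetric. So
`Y_{i,j}` is covered by two closed sets, and truncated identities on one side of `l` with zeros on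
the other show that neither suffices (`not_isIrreducible_rankVariety`).

Irreducibility: if `(i,j) ∈ J(d)` and `d_i ≤ d_j`, then `r_{i,j} = d_i` and `Y_{i,j}` consists of
the `A` with `v A_{(i,j)} = 0` for some `v ≠ 0`. As interior dimensions exceed `d_j`, a small
perturbation makes `v` survive up to vertex `j-1` (`rowKilled_subset_closure`). The locus where it
does is dense in `Y_{i,j}` and is covered by a polynomial map from an affine space into `Y_{i,j}`,
whose image is irreducible (`isIrreducible_rowKilled_self`). The case `d_j ≤ d_i` uses column
vectors. -/

/-- `f` is given by a polynomial in the coordinates `c`. -/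
def IsPolyFun {K X σ : Type*} [CommRing K] (c : X → σ → K) (f : X → K) : Prop :=
  ∃ p : MvPolynomial σ K, ∀ x, f x = MvPolynomial.eval (c x) p

/-! ### Polynomial functions and their closure properties. -/

namespace IsPolyFun

section

variable {K X σ : Type*} [CommRing K] {c : X → σ → K} {f g : X → K}

theorem const (a : K) : IsPolyFun c (fun _ => a) := ⟨MvPolynomial.C a, by simp⟩

theorem coord (s : σ) : IsPolyFun c (fun x => c x s) := ⟨MvPolynomial.X s, by simp⟩

theorem add (hf : IsPolyFun c f) (hg : IsPolyFun c g) : IsPolyFun c (fun x => f x + g x) := by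
  obtain ⟨p, hp⟩ := hf
  obtain ⟨q, hq⟩ := hg
  exact ⟨p + q, by simp [hp, hq]⟩

theorem sub (hf : IsPolyFun c f) (hg : IsPolyFun c g) : IsPolyFun c (fun x => f x - g x) := by
  obtain ⟨p, hp⟩ := hf
  obtain ⟨q, hq⟩ := hg
  exact ⟨p - q, by simp [hp, hq]⟩

theorem mul (hf : IsPolyFun c f) (hg : IsPolyFun c g) : IsPolyFun c (fun x => f x * g x) := by
  obtain ⟨p, hp⟩ := hf
  obtain ⟨q, hq⟩ := hg
  exact ⟨p * q, by simp [hp, hq]⟩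

theorem sum {ι : Type*} (s : Finset ι) {F : ι → X → K} (h : ∀ i, IsPolyFun c (F i)) :
    IsPolyFun c (fun x => ∑ i ∈ s, F i x) := by
  choose p hp using h
  exact ⟨∑ i ∈ s, p i, by simp [hp]⟩

theorem prod {ι : Type*} (s : Finset ι) {F : ι → X → K} (h : ∀ i, IsPolyFun c (F i)) :
    IsPolyFun c (fun x => ∏ i ∈ s, F i x) := by
  choose p hp using h
  exact ⟨∏ i ∈ s, p i, by simp [hp]⟩

theorem matrix_mul {l m n : Type*} [Fintype m] {M : X → Matrix l m K} {N : X → Matrix m n K}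
    (hM : ∀ a b, IsPolyFun c (fun x => M x a b)) (hN : ∀ a b, IsPolyFun c (fun x => N x a b)) (a : l)
    (b : n) : IsPolyFun c (fun x => (M x * N x) a b) := by
  simp only [Matrix.mul_apply]
  exact sum _ fun k => (hM a k).mul (hN k b)

theorem vecMul {m n : Type*} [Fintype m] {v : X → m → K} {N : X → Matrix m n K}
    (hv : ∀ a, IsPolyFun c (fun x => v x a)) (hN : ∀ a b, IsPolyFun c (fun x => N x a b)) (b : n) :
    IsPolyFun c (fun x => Matrix.vecMul (v x) (N x) b) := by
  simp only [Matrix.vecMul, dotProduct]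
  exact sum _ fun k => (hv k).mul (hN k b)

theorem mulVec {m n : Type*} [Fintype n] {v : X → n → K} {N : X → Matrix m n K}
    (hv : ∀ a, IsPolyFun c (fun x => v x a)) (hN : ∀ a b, IsPolyFun c (fun x => N x a b)) (a : m) :
    IsPolyFun c (fun x => Matrix.mulVec (N x) (v x) a) := by
  simp only [Matrix.mulVec, dotProduct]
  exact sum _ fun k => (hN a k).mul (hv k)

theorem dotProduct {m : Type*} [Fintype m] {v w : X → m → K}
    (hv : ∀ a, IsPolyFun c (fun x => v x a)) (hw : ∀ a, IsPolyFun c (fun x => w x a)) :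
    IsPolyFun c (fun x => v x ⬝ᵥ w x) :=
  sum _ fun k => (hv k).mul (hw k)

theorem det {n : Type*} [Fintype n] [DecidableEq n] {M : X → Matrix n n K}
    (hM : ∀ a b, IsPolyFun c (fun x => M x a b)) : IsPolyFun c (fun x => (M x).det) := by
  simp only [Matrix.det_apply']
  exact sum _ fun e => (const _).mul (prod _ fun k => hM _ _)

theorem comp {Y τ : Type*} {e : Y → τ → K} {ψ : X → Y} {F : Y → K} (hF : IsPolyFun e F)
    (hψ : ∀ s, IsPolyFun c (fun x => e (ψ x) s)) : IsPolyFun c (fun x => F (ψ x)) := by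
  obtain ⟨p, hp⟩ := hF
  choose q hq using hψ
  refine ⟨MvPolynomial.bind₁ q p, fun x => ?_⟩
  change F (ψ x) = _
  rw [hp, ← MvPolynomial.coe_aeval_eq_eval, ← MvPolynomial.coe_aeval_eq_eval]
  simp only [RingHom.coe_coe, MvPolynomial.aeval_bind₁]
  congr 2
  funext s
  refine (hq s x).trans ?_
  rw [← MvPolynomial.coe_aeval_eq_eval]
  rfl

end

/-- Over an infinite field a polynomial is determined by its values, and the polynomial ring is a
domain. This is the source of every irreducibility and density statement below. -/
theorem eq_zero_or_eq_zero {K X σ : Type*} [Field K] [Infinite K] {c : X → σ → K} {f g : X → K}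
    (hc : Function.Surjective c) (hf : IsPolyFun c f) (hg : IsPolyFun c g) (h : ∀ x, f x * g x = 0) :
    (∀ x, f x = 0) ∨ ∀ x, g x = 0 := by
  obtain ⟨p, hp⟩ := hf
  obtain ⟨q, hq⟩ := hg
  have : p * q = 0 := MvPolynomial.funext fun y => by
    obtain ⟨x, rfl⟩ := hc y
    simp [← hp, ← hq, h]
  rcases mul_eq_zero.1 this with rfl | rfl
  · exact .inl fun x => by simp [hp]
  · exact .inr fun x => by simp [hq]

end IsPolyFun

namespace TypeAQuiver

/-! ### Zariski topology: images of affine spaces and density. -/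

section Topology

variable {K : Type*} [Field K] {t : ℕ} {d : ℕ → ℕ}

theorem isClosed_setOf_forall_eq_zero {ι : Type*} {F : ι → RepSpace K t d → K}
    (hF : ∀ i, IsPolyFun coords (F i)) : IsClosed {A | ∀ i, F i A = 0} := by
  choose p hp using hF
  rw [isClosed_iff_zeroSet]
  exact ⟨Set.range p, by ext A; simp [zeroSet, hp]⟩

theorem exists_isPolyFun_of_isOpen {U : Set (RepSpace K t d)} (hU : IsOpen U) {A : RepSpace K t d}
    (hA : A ∈ U) : ∃ F : RepSpace K t d → K, IsPolyFun coords F ∧ F A ≠ 0 ∧ ∀ B, F B ≠ 0 → B ∈ U := by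
  obtain ⟨P, hP⟩ := (isClosed_iff_zeroSet _).1 hU.isClosed_compl
  have hA' : A ∉ zeroSet P := by rw [← hP]; simpa using hA
  simp only [zeroSet, Set.mem_ofPred_eq, not_forall] at hA'
  obtain ⟨p, hp, hpA⟩ := hA'
  refine ⟨fun B => MvPolynomial.eval (coords B) p, ⟨p, fun _ => rfl⟩, hpA, fun B hB => ?_⟩
  by_contra hBU
  have : B ∈ zeroSet P := by rw [← hP]; exact hBU
  exact hB (this p hp)

variable [Infinite K] {X σ : Type*} {c : X → σ → K} {ψ : X → RepSpace K t d}

theorem isIrreducible_range_of_isPolyFun [Nonempty X] (hc : Function.Surjective c)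
    (hψ : ∀ e, IsPolyFun c (fun x => coords (ψ x) e)) : IsIrreducible (Set.range ψ) := by
  refine ⟨Set.range_nonempty _, ?_⟩
  rintro U V hU hV ⟨_, ⟨x, rfl⟩, hx⟩ ⟨_, ⟨y, rfl⟩, hy⟩
  obtain ⟨F, hF, hFx, hFU⟩ := exists_isPolyFun_of_isOpen hU hx
  obtain ⟨G, hG, hGy, hGV⟩ := exists_isPolyFun_of_isOpen hV hy
  by_contra hcon
  rcases IsPolyFun.eq_zero_or_eq_zero hc (hF.comp hψ) (hG.comp hψ) (fun z => by
    by_contra hz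
    exact hcon ⟨ψ z, ⟨z, rfl⟩, hFU _ (left_ne_zero_of_mul hz), hGV _ (right_ne_zero_of_mul hz)⟩)
    with h | h
  · exact hFx (h x)
  · exact hGy (h y)

/-- The locus `q ≠ 0` is dense in the affine parameter space, so its image is dense in the image of
`ψ`. -/
theorem mem_closure_of_isPolyFun (hc : Function.Surjective c)
    (hψ : ∀ e, IsPolyFun c (fun x => coords (ψ x) e)) {q : X → K} (hq : IsPolyFun c q)
    (hq0 : ∃ x, q x ≠ 0) {S : Set (RepSpace K t d)} (hS : ∀ x, q x ≠ 0 → ψ x ∈ S) (x : X) :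
    ψ x ∈ closure S := by
  rw [mem_closure_iff]
  intro U hU hx
  obtain ⟨F, hF, hFx, hFU⟩ := exists_isPolyFun_of_isOpen hU hx
  by_contra hcon
  rcases IsPolyFun.eq_zero_or_eq_zero hc (hF.comp hψ) hq (fun z => by
    by_contra hz
    exact hcon ⟨ψ z, hFU _ (left_ne_zero_of_mul hz), hS _ (right_ne_zero_of_mul hz)⟩)
    with h | h
  · exact hFx (h x)
  · exact hq0.elim fun y hy => hy (h y)

end Topology

/-! ### Path products and changing a single arrow. -/

section Paths

variable {K : Type*} [Field K] {t : ℕ} {d : ℕ → ℕ}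

/-- The product `A_{a,a+1} ⋯ A_{b-1,b}` as a `d a × d b` matrix; the zero matrix if `b < a`. -/
def pathMat (A : RepSpace K t d) (a b : ℕ) : Matrix (Fin (d a)) (Fin (d b)) K :=
  if h : a ≤ b then
    (pathProd A a (b - a)).submatrix id (Fin.cast (congrArg d (Nat.add_sub_of_le h).symm))
  else 0

theorem pathMat_add (A : RepSpace K t d) (a m : ℕ) : pathMat A a (a + m) = pathProd A a m := by
  -- `a + (b - a)` and `b` are equal only propositionally; with the length `n` left free,
  -- substitution removes the cast.
  have key : ∀ (n : ℕ) (hn : n = m) (h : d (a + m) = d (a + n)),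
      (pathProd A a n).submatrix id (Fin.cast h) = pathProd A a m := by
    rintro n rfl h
    rfl
  rw [pathMat, dif_pos (Nat.le_add_right a m)]
  exact key _ (Nat.add_sub_cancel_left ..) _

theorem pathMat_self (A : RepSpace K t d) (a : ℕ) : pathMat A a a = 1 := pathMat_add A a 0

theorem pathMat_succ (A : RepSpace K t d) {a b : ℕ} (h : a ≤ b) :
    pathMat A a (b + 1) = pathMat A a b * arrow A b := by
  obtain ⟨m, rfl⟩ := Nat.exists_eq_add_of_le h
  rw [pathMat_add]
  exact pathMat_add A a (m + 1)

theorem pathMat_mul_pathMat (A : RepSpace K t d) {a b c : ℕ} (hab : a ≤ b) (hbc : b ≤ c) :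
    pathMat A a b * pathMat A b c = pathMat A a c := by
  induction c, hbc using Nat.le_induction with
  | base => rw [pathMat_self, Matrix.mul_one]
  | succ c hbc ih => rw [pathMat_succ A hbc, pathMat_succ A (hab.trans hbc), ← ih, Matrix.mul_assoc]

theorem pathMat_succ_left (A : RepSpace K t d) {a b : ℕ} (h : a < b) :
    pathMat A a b = arrow A a * pathMat A (a + 1) b := by
  rw [← pathMat_mul_pathMat A (Nat.le_succ a) h, pathMat_succ A le_rfl, pathMat_self,
    Matrix.one_mul]

theorem rank_pathMat (A : RepSpace K t d) {a b : ℕ} (h : a ≤ b) :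
    (pathMat A a b).rank = pathRank A a b := by
  obtain ⟨m, rfl⟩ := Nat.exists_eq_add_of_le h
  rw [pathMat_add, pathRank, Nat.add_sub_cancel_left]

theorem pathMat_congr {A B : RepSpace K t d} {a b : ℕ} (hab : a ≤ b)
    (h : ∀ l, a ≤ l → l < b → arrow A l = arrow B l) : pathMat A a b = pathMat B a b := by
  induction b, hab using Nat.le_induction with
  | base => simp only [pathMat_self]
  | succ b hab ih =>
    rw [pathMat_succ A hab, pathMat_succ B hab, h b hab (Nat.lt_succ_self b),
      ih fun l hl hlb => h l hl (Nat.lt_succ_of_lt hlb)]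

/-- The representation `A` with the matrix `A_{k,k+1}` replaced by `M`. -/
def setArrow (A : RepSpace K t d) (k : ℕ) (hk : k ∈ Finset.Ico 1 t)
    (M : Matrix (Fin (d k)) (Fin (d (k + 1))) K) : RepSpace K t d :=
  Function.update A ⟨k, hk⟩ M

variable (A : RepSpace K t d) {k : ℕ} (hk : k ∈ Finset.Ico 1 t)
  (M : Matrix (Fin (d k)) (Fin (d (k + 1))) K)

theorem arrow_setArrow : arrow (setArrow A k hk M) k = M := by
  rw [arrow, dif_pos hk]
  exact Function.update_self ..

theorem arrow_setArrow_of_ne {l : ℕ} (hl : l ≠ k) :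
    arrow (setArrow A k hk M) l = arrow A l := by
  unfold arrow
  split_ifs with h
  · exact Function.update_of_ne (by simpa using hl) ..
  · rfl

theorem setArrow_arrow : setArrow A k hk (arrow A k) = A := by
  rw [arrow, dif_pos hk]
  exact Function.update_eq_self ..

theorem pathMat_setArrow_of_le {a b : ℕ} (hab : a ≤ b) (hb : b ≤ k) :
    pathMat (setArrow A k hk M) a b = pathMat A a b :=
  pathMat_congr hab fun _ _ hl => arrow_setArrow_of_ne A hk M (hl.trans_le hb).ne

theorem pathMat_setArrow_of_lt {a b : ℕ} (hab : a ≤ b) (ha : k < a) :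
    pathMat (setArrow A k hk M) a b = pathMat A a b :=
  pathMat_congr hab fun _ hl _ => arrow_setArrow_of_ne A hk M (ha.trans_le hl).ne'

variable {X σ : Type*} {c : X → σ → K}

theorem isPolyFun_arrow {ψ : X → RepSpace K t d} (hψ : ∀ e, IsPolyFun c (fun x => coords (ψ x) e))
    (l : ℕ) (p : Fin (d l)) (q : Fin (d (l + 1))) : IsPolyFun c (fun x => arrow (ψ x) l p q) := by
  unfold arrow
  split_ifs with h
  · exact hψ ⟨⟨l, h⟩, p, q⟩
  · exact IsPolyFun.const 0

theorem isPolyFun_pathMat {ψ : X → RepSpace K t d} (hψ : ∀ e, IsPolyFun c (fun x => coords (ψ x) e))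
    {a b : ℕ} (hab : a ≤ b) (p : Fin (d a)) (q : Fin (d b)) :
    IsPolyFun c (fun x => pathMat (ψ x) a b p q) := by
  induction b, hab using Nat.le_induction with
  | base => simp only [pathMat_self]; exact IsPolyFun.const _
  | succ b hab ih =>
    simp only [pathMat_succ _ hab]
    exact IsPolyFun.matrix_mul (fun p q => ih q) (fun p q => isPolyFun_arrow hψ b p q) p q

theorem isPolyFun_setArrow {ψ : X → RepSpace K t d} (hψ : ∀ e, IsPolyFun c (fun x => coords (ψ x) e))
    {N : X → Matrix (Fin (d k)) (Fin (d (k + 1))) K} (hN : ∀ p q, IsPolyFun c (fun x => N x p q))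
    (e : Coord t d) : IsPolyFun c (fun x => coords (setArrow (ψ x) k hk (N x)) e) := by
  obtain ⟨⟨l, hl⟩, p, q⟩ := e
  by_cases h : l = k
  · subst h
    convert hN p q using 2 with x
    exact congrFun (congrFun (Function.update_self ..) p) q
  · have : (⟨l, hl⟩ : Finset.Ico 1 t) ≠ ⟨k, hk⟩ := by simpa using h
    convert hψ ⟨⟨l, hl⟩, p, q⟩ using 2 with x
    exact congrFun (congrFun (Function.update_of_ne this ..) p) q

end Paths

end TypeAQuiver

/-! ### Rank criteria for matrices. -/

namespace Matrix

variable {K m n : Type*} [Field K] [Fintype n]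

theorem rank_lt_card_iff_exists_mulVec (M : Matrix m n K) :
    M.rank < Fintype.card n ↔ ∃ u : n → K, u ≠ 0 ∧ M *ᵥ u = 0 := by
  classical
  have h := LinearMap.finrank_range_add_finrank_ker M.mulVecLin
  rw [Module.finrank_fintype_fun_eq_card] at h
  have h2 : M.rank < Fintype.card n ↔ 0 < Module.finrank K (LinearMap.ker M.mulVecLin) := by
    rw [Matrix.rank]; omega
  rw [h2, Nat.pos_iff_ne_zero, Ne, Submodule.finrank_eq_zero, Submodule.eq_bot_iff]
  push Not
  simp only [LinearMap.mem_ker, mulVecLin_apply]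
  exact exists_congr fun u => and_comm

variable [Fintype m]

theorem rank_lt_card_iff_exists_vecMul (M : Matrix m n K) :
    M.rank < Fintype.card m ↔ ∃ v : m → K, v ≠ 0 ∧ v ᵥ* M = 0 := by
  rw [← rank_transpose, rank_lt_card_iff_exists_mulVec]
  simp only [mulVec_transpose]

/-- Arbitrary `P` and `Q` replace the choice of a minor; the polynomial conditions `det (P M Q) = 0`
thus make `rk M < r` closed. For the forward direction, `Q` has as columns preimages of `r`
independent vectors of the range and `P` is a left inverse of these vectors, so `P M Q = 1`. -/
theorem le_rank_iff_exists_det_ne_zero (M : Matrix m n K) (r : ℕ) :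
    r ≤ M.rank ↔ ∃ (P : Matrix (Fin r) m K) (Q : Matrix n (Fin r) K), (P * M * Q).det ≠ 0 := by
  classical
  constructor
  · intro h
    obtain ⟨v, hv⟩ := exists_linearIndependent_of_le_finrank (R := K)
      (M := LinearMap.range M.mulVecLin) h
    have hv' : LinearIndependent K (fun s => (v s : m → K)) :=
      hv.map' (Submodule.subtype _) (Submodule.ker_subtype _)
    choose u hu using fun s => (v s).2
    obtain ⟨g, hg⟩ := LinearMap.exists_leftInverse_of_injective
      (Fintype.linearCombination K (fun s => (v s : m → K)))
      (LinearMap.ker_eq_bot.2 hv'.fintypeLinearCombination_injective)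
    refine ⟨LinearMap.toMatrix' g, (Matrix.of u)ᵀ, ?_⟩
    suffices h1 : LinearMap.toMatrix' g * M * (Matrix.of u)ᵀ = 1 by simp [h1]
    apply Matrix.toLin'.injective
    rw [Matrix.mul_assoc, toLin'_mul, toLin'_toMatrix', toLin'_one, ← hg]
    congr 1
    refine LinearMap.pi_ext' fun s => LinearMap.ext_ring ?_
    have h2 : M *ᵥ u s = v s := hu s
    simp [Fintype.linearCombination_apply_single, ← h2]
  · rintro ⟨P, Q, h⟩
    have h1 := rank_of_isUnit _ ((isUnit_iff_isUnit_det _).2 (isUnit_iff_ne_zero.2 h))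
    rw [Fintype.card_fin] at h1
    rw [← h1]
    exact (rank_mul_le_left _ _).trans (rank_mul_le_right _ _)

variable {l : Type*}

theorem rank_mul_eq_left_of_card_le_rank (M : Matrix l m K) (N : Matrix m n K)
    (h : Fintype.card m ≤ N.rank) : (M * N).rank = M.rank := by
  classical
  have hs : LinearMap.range N.mulVecLin = ⊤ := by
    apply Submodule.eq_top_of_finrank_eq
    rw [Module.finrank_fintype_fun_eq_card]
    exact le_antisymm (rank_le_card_height N) h
  rw [rank, mulVecLin_mul, LinearMap.range_comp, hs, Submodule.map_top, rank]

theorem rank_mul_eq_right_of_card_le_rank [Fintype l] (M : Matrix l m K) (N : Matrix m n K)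
    (h : Fintype.card m ≤ M.rank) : (M * N).rank = N.rank := by
  rw [← rank_transpose, transpose_mul, rank_mul_eq_left_of_card_le_rank _ _
    (by rwa [rank_transpose]), rank_transpose]

theorem exists_dotProduct_eq_one {w : m → K} (hw : w ≠ 0) : ∃ u, w ⬝ᵥ u = 1 := by
  classical
  obtain ⟨s, hs⟩ := Function.ne_iff.1 hw
  exact ⟨Pi.single s (w s)⁻¹, by simpa using mul_inv_cancel₀ hs⟩

end Matrix

/-! ### General topology of irreducible sets. -/

theorem exists_not_subset_irreducibleComponents {X : Type*} [TopologicalSpace X] {S : Set X}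
    (hne : S.Nonempty) (hS : ¬ IsIrreducible S) :
    ∃ Z₁ ∈ irreducibleComponents S, ∃ Z₂ ∈ irreducibleComponents S, ¬ Z₁ ⊆ Z₂ ∧ ¬ Z₂ ⊆ Z₁ := by
  obtain ⟨x, hx⟩ := hne
  set Z₁ := irreducibleComponent (⟨x, hx⟩ : S)
  have hZ₁ : Z₁ ∈ irreducibleComponents S := irreducibleComponent_mem_irreducibleComponents _
  by_cases h : Z₁ = Set.univ
  · refine absurd ?_ hS
    have h1 : IsIrreducible (Set.univ : Set S) := h ▸ isIrreducible_irreducibleComponent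
    simpa using h1.image Subtype.val continuous_subtype_val.continuousOn
  -- The component of a point outside `Z₁` is not inside `Z₁`; maximality of `Z₁` excludes the other
  -- inclusion.
  · obtain ⟨y, hy⟩ := (Set.ne_univ_iff_exists_notMem _).1 h
    have h2 : ¬ irreducibleComponent y ⊆ Z₁ := fun h2 => hy (h2 mem_irreducibleComponent)
    exact ⟨Z₁, hZ₁, irreducibleComponent y, irreducibleComponent_mem_irreducibleComponents y,
      fun h1 => h2 (hZ₁.2 isIrreducible_irreducibleComponent h1), h2⟩

theorem IsIrreducible.of_subset_closure {X : Type*} [TopologicalSpace X] {S T : Set X}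
    (hS : IsIrreducible S) (hST : S ⊆ T) (hT : T ⊆ closure S) : IsIrreducible T := by
  refine ⟨hS.nonempty.mono hST, ?_⟩
  rw [← isPreirreducible_iff_closure,
    subset_antisymm (closure_minimal hT isClosed_closure) (closure_mono hST)]
  exact hS.isPreirreducible.closure

/-! ### Reducibility when `(i,j) ∉ J(d)`. -/

namespace TypeAQuiver

theorem genericRank_eq {d : ℕ → ℕ} {i j r : ℕ} (h : ∃ l, i ≤ l ∧ l ≤ j ∧ d l = r)
    (hr : ∀ l, i ≤ l → l ≤ j → r ≤ d l) : genericRank d i j = r := by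
  obtain ⟨l, hil, hlj, rfl⟩ := h
  refine le_antisymm (Nat.sInf_le ⟨l, ⟨hil, hlj⟩, rfl⟩) (le_csInf ⟨_, l, ⟨hil, hlj⟩, rfl⟩ ?_)
  rintro _ ⟨m, ⟨h1, h2⟩, rfl⟩
  exact hr m h1 h2

section Reducible

variable {K : Type*} [Field K] {t : ℕ} {d : ℕ → ℕ}

theorem isClosed_setOf_rank_pathMat_lt {a b : ℕ} (hab : a ≤ b) (r : ℕ) :
    IsClosed {A : RepSpace K t d | (pathMat A a b).rank < r} := by
  convert isClosed_setOf_forall_eq_zero (K := K) (t := t) (d := d)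
    (F := fun (PQ : Matrix (Fin r) (Fin (d a)) K × Matrix (Fin (d b)) (Fin r) K) A =>
      (PQ.1 * pathMat A a b * PQ.2).det) (fun PQ => IsPolyFun.det (IsPolyFun.matrix_mul
        (IsPolyFun.matrix_mul (fun _ _ => IsPolyFun.const _) (isPolyFun_pathMat (ψ := id) IsPolyFun.coord hab))
        (fun _ _ => IsPolyFun.const _))) using 1
  ext A
  simp only [Set.mem_ofPred_eq]
  rw [← not_le, Matrix.le_rank_iff_exists_det_ne_zero]
  push Not
  simp [Prod.forall]

variable (K t d) in
/-- The representation whose matrices are the truncated identity matrices at the arrows `l` with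
`a ≤ l < b`, and zero at the other arrows. -/
def stdRep (a b : ℕ) : RepSpace K t d :=
  fun l => if a ≤ l ∧ l < b then Matrix.of fun p q => if (p : ℕ) = q then 1 else 0 else 0

theorem le_rank_pathMat_stdRep {a b r : ℕ} (ha : 1 ≤ a) (hab : a ≤ b) (hb : b ≤ t)
    (hr : ∀ l, a ≤ l → l ≤ b → r ≤ d l) : r ≤ (pathMat (stdRep K t d a b) a b).rank := by
  let P (l : ℕ) : Matrix (Fin r) (Fin (d l)) K := Matrix.of fun p q => if (p : ℕ) = q then 1 else 0
  -- Truncated identities compose to truncated identities, since no intermediate dimension is below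
  -- `r`.
  have key : ∀ c, a ≤ c → c ≤ b → P a * pathMat (stdRep K t d a b) a c = P c := by
    intro c hac
    induction c, hac using Nat.le_induction with
    | base => intro; rw [pathMat_self, Matrix.mul_one]
    | succ c hac ih =>
      intro hcb
      rw [pathMat_succ _ hac, ← Matrix.mul_assoc, ih (by omega), arrow,
        dif_pos (by rw [Finset.mem_Ico]; omega), stdRep]
      simp only
      rw [if_pos ⟨hac, hcb⟩]
      ext p q
      have hp : (p : ℕ) < d c := p.2.trans_le (hr c hac (by omega))
      simp only [P, Matrix.mul_apply, Matrix.of_apply]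
      rw [Finset.sum_eq_single ⟨p, hp⟩]
      · simp
      · intro s _ hs
        rw [if_neg (fun h => hs (Fin.ext h.symm)), zero_mul]
      · simp
  have h1 : P b * (P b).transpose = 1 := by
    ext p q
    have hp : (p : ℕ) < d b := p.2.trans_le (hr b hab le_rfl)
    simp only [P, Matrix.mul_apply, Matrix.of_apply, Matrix.transpose_apply]
    rw [Finset.sum_eq_single ⟨p, hp⟩]
    · simp [Matrix.one_apply, Fin.ext_iff, eq_comm]
    · intro s _ hs
      rw [if_neg (fun h => hs (Fin.ext h.symm)), zero_mul]
    · simp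
  calc r = (1 : Matrix (Fin r) (Fin r) K).rank := by simp
    _ ≤ (P b).rank := by rw [← h1]; exact Matrix.rank_mul_le_left _ _
    _ ≤ _ := by rw [← key b hab le_rfl]; exact Matrix.rank_mul_le_right _ _

theorem pathMat_stdRep_eq_zero {a b i j : ℕ}
    (h : ∃ l, i ≤ l ∧ l < j ∧ (l < a ∨ b ≤ l)) : pathMat (stdRep K t d a b) i j = 0 := by
  obtain ⟨l, hil, hlj, hl⟩ := h
  have h0 : arrow (stdRep K t d a b) l = 0 := by
    unfold arrow
    split_ifs
    · exact if_neg (by simp only; omega)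
    · rfl
  rw [← pathMat_mul_pathMat _ hil hlj.le, pathMat_succ_left _ hlj, h0, Matrix.zero_mul,
    Matrix.mul_zero]

theorem not_isIrreducible_of_subset_union {X : Type*} [TopologicalSpace X] {Y Z₁ Z₂ : Set X}
    (h₁ : IsClosed Z₁) (h₂ : IsClosed Z₂) (h : Y ⊆ Z₁ ∪ Z₂) (hY₁ : ¬ Y ⊆ Z₁) (hY₂ : ¬ Y ⊆ Z₂) :
    ¬ IsIrreducible Y := fun hY =>
  (isPreirreducible_iff_isClosed_union_isClosed.1 hY.isPreirreducible Z₁ Z₂ h₁ h₂ h).elim hY₁ hY₂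

theorem stdRep_mem_rankVariety {a b i j : ℕ} (hi : 1 ≤ i) (hij : i ≤ j) (hj : j ≤ t)
    (hd : ∀ l, 1 ≤ l → l ≤ t → 0 < d l) (h : ∃ l, i ≤ l ∧ l < j ∧ (l < a ∨ b ≤ l)) :
    stdRep K t d a b ∈ rankVariety K t d i j := by
  change pathRank _ _ _ < _
  rw [← rank_pathMat _ hij, pathMat_stdRep_eq_zero h, Matrix.rank_zero]
  refine Nat.lt_of_lt_of_le Nat.zero_lt_one (le_csInf ⟨_, i, ⟨le_rfl, hij⟩, rfl⟩ ?_)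
  rintro _ ⟨m, ⟨h1, h2⟩, rfl⟩
  exact hd m (hi.trans h1) (h2.trans hj)

theorem not_isIrreducible_rankVariety {i j : ℕ} (hd : ∀ l, 1 ≤ l → l ≤ t → 0 < d l) (hi : 1 ≤ i)
    (hij : i < j) (hj : j ≤ t) (hJ : (i, j) ∉ J t d) : ¬ IsIrreducible (rankVariety K t d i j) := by
  obtain ⟨m, him, hmj, hm⟩ : ∃ m, i < m ∧ m < j ∧ d m ≤ max (d i) (d j) := by
    by_contra! hcon
    exact hJ ⟨hi, hij, hj, hcon⟩
  -- Minimality of `d l` makes the generic ranks of both halves and of the whole path depend only on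
  -- `d i`, `d l`, `d j`.
  obtain ⟨l, hl, hmin⟩ := Finset.exists_min_image (Finset.Ioo i j) d ⟨m, by simp [him, hmj]⟩
  simp only [Finset.mem_Ioo] at hl hmin
  obtain ⟨hil, hlj⟩ := hl
  have hlm : d l ≤ max (d i) (d j) := (hmin m ⟨him, hmj⟩).trans hm
  have mem₁ : stdRep K t d i l ∈ rankVariety K t d i j :=
    stdRep_mem_rankVariety hi hij.le hj hd ⟨l, hil.le, hlj, .inr le_rfl⟩
  have mem₂ : stdRep K t d l j ∈ rankVariety K t d i j :=
    stdRep_mem_rankVariety hi hij.le hj hd ⟨i, le_rfl, hij, .inl hil⟩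
  rcases le_max_iff.1 hlm with hle | hle
  · have hr : genericRank d i j = min (d l) (d j) := by
      refine genericRank_eq ?_ fun k hk hk' => ?_
      · rcases min_choice (d l) (d j) with h | h
        · exact ⟨l, hil.le, hlj.le, h.symm⟩
        · exact ⟨j, hij.le, le_rfl, h.symm⟩
      · rcases hk.eq_or_lt with rfl | hk
        · exact (min_le_left _ _).trans hle
        rcases hk'.eq_or_lt with rfl | hk'
        · exact min_le_right _ _
        exact (min_le_left _ _).trans (hmin k ⟨hk, hk'⟩)
    refine not_isIrreducible_of_subset_union
      (isClosed_setOf_rank_pathMat_lt hlj.le (min (d l) (d j)))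
      (isClosed_setOf_rank_pathMat_lt hil.le (d l)) (fun A hA => ?_) (fun h => ?_) (fun h => ?_)
    -- Outside the second closed set `A_{(i,l)}` has full column rank, hence does not change the
    -- rank of `A_{(l,j)}`.
    · by_contra hcon
      simp only [Set.mem_union, Set.mem_ofPred_eq, not_or, not_lt] at hcon
      change pathRank _ _ _ < _ at hA
      rw [hr, ← rank_pathMat _ hij.le, ← pathMat_mul_pathMat A hil.le hlj.le,
        Matrix.rank_mul_eq_right_of_card_le_rank _ _ (by simpa using hcon.2)] at hA
      omega
    · refine (h mem₂).not_ge (le_rank_pathMat_stdRep (hi.trans hil.le) hlj.le hj fun k h1 h2 => ?_)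
      rcases h2.eq_or_lt with rfl | h2
      · exact min_le_right _ _
      · exact (min_le_left _ _).trans (hmin k ⟨hil.trans_le h1, h2⟩)
    · refine (h mem₁).not_ge (le_rank_pathMat_stdRep hi hil.le (hlj.le.trans hj) fun k h1 h2 => ?_)
      rcases h1.eq_or_lt with rfl | h1
      · exact hle
      · exact hmin k ⟨h1, h2.trans_lt hlj⟩
  · have hr : genericRank d i j = min (d i) (d l) := by
      refine genericRank_eq ?_ fun k hk hk' => ?_
      · rcases min_choice (d i) (d l) with h | h
        · exact ⟨i, le_rfl, hij.le, h.symm⟩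
        · exact ⟨l, hil.le, hlj.le, h.symm⟩
      · rcases hk.eq_or_lt with rfl | hk
        · exact min_le_left _ _
        rcases hk'.eq_or_lt with rfl | hk'
        · exact (min_le_right _ _).trans hle
        exact (min_le_right _ _).trans (hmin k ⟨hk, hk'⟩)
    refine not_isIrreducible_of_subset_union
      (isClosed_setOf_rank_pathMat_lt hil.le (min (d i) (d l)))
      (isClosed_setOf_rank_pathMat_lt hlj.le (d l)) (fun A hA => ?_) (fun h => ?_) (fun h => ?_)
    · by_contra hcon
      simp only [Set.mem_union, Set.mem_ofPred_eq, not_or, not_lt] at hcon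
      change pathRank _ _ _ < _ at hA
      rw [hr, ← rank_pathMat _ hij.le, ← pathMat_mul_pathMat A hil.le hlj.le,
        Matrix.rank_mul_eq_left_of_card_le_rank _ _ (by simpa using hcon.2)] at hA
      omega
    · refine (h mem₁).not_ge (le_rank_pathMat_stdRep hi hil.le (hlj.le.trans hj) fun k h1 h2 => ?_)
      rcases h1.eq_or_lt with rfl | h1
      · exact min_le_left _ _
      · exact (min_le_right _ _).trans (hmin k ⟨h1, h2.trans_lt hlj⟩)
    · refine (h mem₂).not_ge (le_rank_pathMat_stdRep (hi.trans hil.le) hlj.le hj fun k h1 h2 => ?_)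
      rcases h2.eq_or_lt with rfl | h2
      · exact hle
      · exact hmin k ⟨hil.trans_le h1, h2⟩

end Reducible

end TypeAQuiver

/-! ### Irreducibility when `(i,j) ∈ J(d)`. -/

namespace TypeAQuiver

theorem coords_surjective {K : Type*} {t : ℕ} {d : ℕ → ℕ} : Function.Surjective (coords : RepSpace K t d → Coord t d → K) :=
  fun y => ⟨fun l p q => y ⟨l, p, q⟩, rfl⟩

section Irreducible

variable {K : Type*} [Field K] {t : ℕ} {d : ℕ → ℕ}

/-- Coordinates on the product of the representation space with two vector spaces. -/
def paramCoords (K : Type*) [Field K] (t : ℕ) (d : ℕ → ℕ) (m n : ℕ) :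
    RepSpace K t d × (Fin m → K) × (Fin n → K) → Coord t d ⊕ Fin m ⊕ Fin n → K :=
  fun x => Sum.elim (coords x.1) (Sum.elim x.2.1 x.2.2)

theorem paramCoords_surjective (m n : ℕ) : Function.Surjective (paramCoords K t d m n) := by
  intro y
  obtain ⟨A, hA⟩ := coords_surjective (K := K) (y ∘ Sum.inl)
  refine ⟨(A, y ∘ Sum.inr ∘ Sum.inl, y ∘ Sum.inr ∘ Sum.inr), ?_⟩
  funext s
  rcases s with s | s | s
  · exact congrFun hA s
  · rfl
  · rfl

/-- Representations with a row vector that is annihilated by `A_{(i,j)}` but not by `A_{(i,k)}`. -/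
def rowKilled (K : Type*) [Field K] (t : ℕ) (d : ℕ → ℕ) (i k j : ℕ) : Set (RepSpace K t d) :=
  {A | ∃ v, Matrix.vecMul v (pathMat A i k) ≠ 0 ∧ Matrix.vecMul v (pathMat A i j) = 0}

/-- Representations with a column vector that is annihilated by `A_{(i,j)}` but not by
`A_{(k,j)}`. -/
def colKilled (K : Type*) [Field K] (t : ℕ) (d : ℕ → ℕ) (i k j : ℕ) : Set (RepSpace K t d) :=
  {A | ∃ u, Matrix.mulVec (pathMat A k j) u ≠ 0 ∧ Matrix.mulVec (pathMat A i j) u = 0}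

/-- Since `A_{(i,i)} = 1`, the vector need only be nonzero. When `d_i = r_{i,j}` this set is
`Y_{i,j}`. -/
theorem rowKilled_self {i j : ℕ} (hij : i ≤ j) :
    rowKilled K t d i i j = {A | pathRank A i j < d i} := by
  ext A
  have := Matrix.rank_lt_card_iff_exists_vecMul (pathMat A i j)
  rw [Fintype.card_fin, rank_pathMat A hij] at this
  simp [rowKilled, pathMat_self, this]

theorem colKilled_self {i j : ℕ} (hij : i ≤ j) :
    colKilled K t d i j j = {A | pathRank A i j < d j} := by
  ext A
  have := Matrix.rank_lt_card_iff_exists_mulVec (pathMat A i j)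
  rw [Fintype.card_fin, rank_pathMat A hij] at this
  simp [colKilled, pathMat_self, this]

variable [Infinite K]

/-- On the affine line `s ↦ A_k + s N`, the punctured line is dense, so `s = 0` is a limit of `s ≠
0`. -/
theorem mem_closure_of_setArrow_line (A : RepSpace K t d) {k : ℕ} (hk : k ∈ Finset.Ico 1 t)
    (N : Matrix (Fin (d k)) (Fin (d (k + 1))) K) {S : Set (RepSpace K t d)}
    (hS : ∀ s : K, s ≠ 0 → setArrow A k hk (arrow A k + s • N) ∈ S) : A ∈ closure S := by
  have := mem_closure_of_isPolyFun (X := K) (c := fun s (_ : Unit) => s)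
    (ψ := fun s => setArrow A k hk (arrow A k + s • N)) (q := id) (S := S)
    (fun y => ⟨y (), rfl⟩)
    (isPolyFun_setArrow (ψ := fun _ => A) hk (fun e => IsPolyFun.const _)
      (fun p q => (IsPolyFun.const _).add ((IsPolyFun.coord ()).mul (IsPolyFun.const (N p q)))))
    (IsPolyFun.coord ()) ⟨1, one_ne_zero⟩ hS 0
  simpa [setArrow_arrow] using this

/-- If `v` dies at vertex `k + 1`, add `s • u x` to `A_k`, where `(v A_{(i,k)}) u = 1` and `x ≠ 0`
satisfies `x A_{(k+1,j)} = 0`; such an `x` exists because `d_j < d_{k+1}`. Then `v` is sent to `s x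
≠ 0` and still dies at `j`. -/
theorem rowKilled_subset_closure_succ {i k j : ℕ} (hi : 1 ≤ i) (hik : i ≤ k) (hkj : k + 1 < j)
    (hj : j ≤ t) (hd : d j < d (k + 1)) :
    rowKilled K t d i k j ⊆ closure (rowKilled K t d i (k + 1) j) := by
  rintro A ⟨v, hv, hvj⟩
  have hk : k ∈ Finset.Ico 1 t := by rw [Finset.mem_Ico]; omega
  by_cases h : Matrix.vecMul v (pathMat A i (k + 1)) = 0
  swap
  · exact subset_closure ⟨v, h, hvj⟩
  obtain ⟨u, hu⟩ := Matrix.exists_dotProduct_eq_one hv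
  obtain ⟨x, hx0, hx⟩ := (Matrix.rank_lt_card_iff_exists_vecMul (pathMat A (k + 1) j)).1
    ((Matrix.rank_le_width _).trans_lt (by simpa using hd))
  refine mem_closure_of_setArrow_line A hk (Matrix.vecMulVec u x) fun s hs => ?_
  have key : Matrix.vecMul v (pathMat (setArrow A k hk (arrow A k + s • Matrix.vecMulVec u x))
      i (k + 1)) = s • x := by
    rw [pathMat_succ A hik, ← Matrix.vecMul_vecMul] at h
    rw [pathMat_succ _ hik, ← Matrix.vecMul_vecMul, arrow_setArrow,
      pathMat_setArrow_of_le A hk _ hik le_rfl, Matrix.vecMul_add, h, zero_add,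
      Matrix.vecMul_smul, Matrix.vecMul_vecMulVec, hu, one_smul]
  refine ⟨v, ?_, ?_⟩
  · rw [key]
    exact smul_ne_zero hs hx0
  · rw [← pathMat_mul_pathMat _ (hik.trans k.le_succ) hkj.le, ← Matrix.vecMul_vecMul, key,
      pathMat_setArrow_of_lt A hk _ hkj.le k.lt_succ_self, Matrix.smul_vecMul, hx, smul_zero]

/-- Transposed argument: `x ≠ 0` lies in the kernel of `A_{(i,k)}`, which is nonzero because `d_i <
d_k`. -/
theorem colKilled_succ_subset_closure {i k j : ℕ} (hi : 1 ≤ i) (hik : i < k) (hkj : k < j)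
    (hj : j ≤ t) (hd : d i < d k) :
    colKilled K t d i (k + 1) j ⊆ closure (colKilled K t d i k j) := by
  rintro A ⟨v, hv, hvj⟩
  have hk : k ∈ Finset.Ico 1 t := by rw [Finset.mem_Ico]; omega
  by_cases h : Matrix.mulVec (pathMat A k j) v = 0
  swap
  · exact subset_closure ⟨v, h, hvj⟩
  obtain ⟨u, hu⟩ := Matrix.exists_dotProduct_eq_one hv
  obtain ⟨x, hx0, hx⟩ := (Matrix.rank_lt_card_iff_exists_mulVec (pathMat A i k)).1
    ((Matrix.rank_le_height _).trans_lt (by simpa using hd))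
  refine mem_closure_of_setArrow_line A hk (Matrix.vecMulVec x u) fun s hs => ?_
  have key : Matrix.mulVec (pathMat (setArrow A k hk (arrow A k + s • Matrix.vecMulVec x u))
      k j) v = s • x := by
    rw [pathMat_succ_left A hkj, ← Matrix.mulVec_mulVec] at h
    rw [dotProduct_comm] at hu
    rw [pathMat_succ_left _ hkj, ← Matrix.mulVec_mulVec, arrow_setArrow,
      pathMat_setArrow_of_lt A hk _ hkj k.lt_succ_self, Matrix.add_mulVec, h, zero_add,
      Matrix.smul_mulVec, Matrix.vecMulVec_mulVec, hu]
    simp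
  refine ⟨v, ?_, ?_⟩
  · rw [key]
    exact smul_ne_zero hs hx0
  · rw [← pathMat_mul_pathMat _ hik.le hkj.le, ← Matrix.mulVec_mulVec, key,
      pathMat_setArrow_of_le A hk _ hik.le le_rfl, Matrix.mulVec_smul, hx, smul_zero]

theorem rowKilled_subset_closure {i k n : ℕ} (hi : 1 ≤ i) (hik : i ≤ k) (hkn : k ≤ n)
    (hn : n + 1 ≤ t) (hd : ∀ l, i < l → l < n + 1 → d (n + 1) < d l) :
    rowKilled K t d i i (n + 1) ⊆ closure (rowKilled K t d i k (n + 1)) := by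
  induction k, hik using Nat.le_induction with
  | base => exact subset_closure
  | succ k hik ih =>
    exact (ih (by omega)).trans (closure_minimal (rowKilled_subset_closure_succ hi hik (by omega)
      hn (hd _ (by omega) (by omega))) isClosed_closure)

theorem colKilled_subset_closure {i k j : ℕ} (hi : 1 ≤ i) (hik : i < k) (hkj : k ≤ j)
    (hj : j ≤ t) (hd : ∀ l, i < l → l < j → d i < d l) :
    colKilled K t d i j j ⊆ closure (colKilled K t d i k j) := by
  induction hkj using Nat.decreasingInduction with
  | self => exact subset_closure
  | of_succ k hkj ih =>
    exact (ih (by omega)).trans (closure_minimal (colKilled_succ_subset_closure hi hik hkj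
      hj (hd _ hik hkj)) isClosed_closure)

theorem isIrreducible_rowKilled_self {i j : ℕ} (hi : 1 ≤ i) (hij : i < j) (hj : j ≤ t)
    (hdi : 0 < d i) (hd : ∀ l, i < l → l < j → d j < d l) :
    IsIrreducible (rowKilled K t d i i j) := by
  obtain ⟨n, rfl⟩ : ∃ n, j = n + 1 := ⟨j - 1, by omega⟩
  have hin : i ≤ n := by omega
  have hn : n ∈ Finset.Ico 1 t := by rw [Finset.mem_Ico]; omega
  let w (x : RepSpace K t d × (Fin (d i) → K) × (Fin (d n) → K)) : Fin (d n) → K :=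
    Matrix.vecMul x.2.1 (pathMat x.1 i n)
  -- With `w = v A_{(i,n)}` one has `w N = (w·u) w A_n - (w·u) w A_n = 0` for all parameters,
  -- without division. If `w·u = 1` and `w A_n = 0`, then `N = A_n`.
  let N (x : RepSpace K t d × (Fin (d i) → K) × (Fin (d n) → K)) :
      Matrix (Fin (d n)) (Fin (d (n + 1))) K :=
    (w x ⬝ᵥ x.2.2) • arrow x.1 n - Matrix.vecMulVec x.2.2 (Matrix.vecMul (w x) (arrow x.1 n))
  let ψ x := setArrow x.1 n hn (N x)
  have hA : ∀ e, IsPolyFun (paramCoords K t d (d i) (d n)) (fun x => coords x.1 e) :=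
    fun e => IsPolyFun.coord (c := paramCoords K t d (d i) (d n)) (Sum.inl e)
  have hv : ∀ p, IsPolyFun (paramCoords K t d (d i) (d n)) (fun x => x.2.1 p) :=
    fun p => IsPolyFun.coord (c := paramCoords K t d (d i) (d n)) (Sum.inr (Sum.inl p))
  have hu : ∀ p, IsPolyFun (paramCoords K t d (d i) (d n)) (fun x => x.2.2 p) :=
    fun p => IsPolyFun.coord (c := paramCoords K t d (d i) (d n)) (Sum.inr (Sum.inr p))
  have hw : ∀ p, IsPolyFun (paramCoords K t d (d i) (d n)) (fun x => w x p) :=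
    IsPolyFun.vecMul hv (isPolyFun_pathMat hA hin)
  have hψ : ∀ e, IsPolyFun (paramCoords K t d (d i) (d n)) (fun x => coords (ψ x) e) :=
    isPolyFun_setArrow hn hA fun p q =>
      ((IsPolyFun.dotProduct hw hu).mul (isPolyFun_arrow hA n p q)).sub
        ((hu p).mul (IsPolyFun.vecMul hw (isPolyFun_arrow hA n) q))
  have : Nonempty (RepSpace K t d × (Fin (d i) → K) × (Fin (d n) → K)) := ⟨(fun _ => 0, 0, 0)⟩
  refine (isIrreducible_range_of_isPolyFun (paramCoords_surjective _ _) hψ).of_subset_closure ?_ ?_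
  · rintro _ ⟨x, rfl⟩
    have hpath : pathMat (ψ x) i (n + 1) = pathMat x.1 i n * N x := by
      rw [pathMat_succ _ hin, arrow_setArrow, pathMat_setArrow_of_le _ _ _ hin le_rfl]
    -- If `w = 0`, possibly with `v = 0`, then `N = 0` and the whole product vanishes, so any
    -- nonzero row vector is a witness.
    by_cases hwx : w x = 0
    · refine ⟨fun _ => 1, ?_, ?_⟩
      · rw [pathMat_self, Matrix.vecMul_one]
        exact fun h => one_ne_zero (congrFun h ⟨0, hdi⟩)
      · rw [hpath]
        have h0 : N x = 0 := by ext; simp [N, hwx, Matrix.vecMulVec_apply]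
        rw [h0, Matrix.mul_zero, Matrix.vecMul_zero]
    · refine ⟨x.2.1, ?_, ?_⟩
      · rw [pathMat_self, Matrix.vecMul_one]
        intro h
        exact hwx (by simp [w, h])
      · rw [hpath, ← Matrix.vecMul_vecMul]
        change Matrix.vecMul (w x) (N x) = 0
        simp [N, Matrix.vecMul_sub, Matrix.vecMul_smul, Matrix.vecMul_vecMulVec]
  · refine (rowKilled_subset_closure hi hin le_rfl hj hd).trans (closure_mono ?_)
    rintro A ⟨v, hv, hvj⟩
    obtain ⟨u, hu⟩ := Matrix.exists_dotProduct_eq_one hv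
    rw [pathMat_succ _ hin, ← Matrix.vecMul_vecMul] at hvj
    -- Points of the dense locus are their own images under `ψ`, once `u` is normalised by `w·u =
    -- 1`.
    have hN : N (A, v, u) = arrow A n := by
      ext
      simp only [N, w, hu, hvj, Matrix.sub_apply, Matrix.vecMulVec_apply, Pi.zero_apply, one_smul,
        mul_zero, sub_zero]
    exact ⟨(A, v, u), by simp only [ψ, hN, setArrow_arrow]⟩

theorem isIrreducible_colKilled_self {i j : ℕ} (hi : 1 ≤ i) (hij : i < j) (hj : j ≤ t)
    (hdj : 0 < d j) (hd : ∀ l, i < l → l < j → d i < d l) :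
    IsIrreducible (colKilled K t d i j j) := by
  have hn : i ∈ Finset.Ico 1 t := by rw [Finset.mem_Ico]; omega
  let w (x : RepSpace K t d × (Fin (d j) → K) × (Fin (d (i + 1)) → K)) : Fin (d (i + 1)) → K :=
    Matrix.mulVec (pathMat x.1 (i + 1) j) x.2.1
  -- Transposed correction at the first arrow: `N w = 0` always, and `N = A_i` if `w·u = 1` and `A_i
  -- w = 0`.
  let N (x : RepSpace K t d × (Fin (d j) → K) × (Fin (d (i + 1)) → K)) :
      Matrix (Fin (d i)) (Fin (d (i + 1))) K :=
    (w x ⬝ᵥ x.2.2) • arrow x.1 i - Matrix.vecMulVec (Matrix.mulVec (arrow x.1 i) (w x)) x.2.2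
  let ψ x := setArrow x.1 i hn (N x)
  have hA : ∀ e, IsPolyFun (paramCoords K t d (d j) (d (i + 1))) (fun x => coords x.1 e) :=
    fun e => IsPolyFun.coord (c := paramCoords K t d (d j) (d (i + 1))) (Sum.inl e)
  have hv : ∀ p, IsPolyFun (paramCoords K t d (d j) (d (i + 1))) (fun x => x.2.1 p) :=
    fun p => IsPolyFun.coord (c := paramCoords K t d (d j) (d (i + 1))) (Sum.inr (Sum.inl p))
  have hu : ∀ p, IsPolyFun (paramCoords K t d (d j) (d (i + 1))) (fun x => x.2.2 p) :=
    fun p => IsPolyFun.coord (c := paramCoords K t d (d j) (d (i + 1))) (Sum.inr (Sum.inr p))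
  have hw : ∀ p, IsPolyFun (paramCoords K t d (d j) (d (i + 1))) (fun x => w x p) :=
    IsPolyFun.mulVec hv (isPolyFun_pathMat hA hij)
  have hψ : ∀ e, IsPolyFun (paramCoords K t d (d j) (d (i + 1))) (fun x => coords (ψ x) e) :=
    isPolyFun_setArrow hn hA fun p q =>
      ((IsPolyFun.dotProduct hw hu).mul (isPolyFun_arrow hA i p q)).sub
        ((IsPolyFun.mulVec hw (isPolyFun_arrow hA i) p).mul (hu q))
  have : Nonempty (RepSpace K t d × (Fin (d j) → K) × (Fin (d (i + 1)) → K)) :=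
    ⟨(fun _ => 0, 0, 0)⟩
  refine (isIrreducible_range_of_isPolyFun (paramCoords_surjective _ _) hψ).of_subset_closure ?_ ?_
  · rintro _ ⟨x, rfl⟩
    have hpath : pathMat (ψ x) i j = N x * pathMat x.1 (i + 1) j := by
      rw [pathMat_succ_left _ hij, arrow_setArrow,
        pathMat_setArrow_of_lt _ _ _ hij i.lt_succ_self]
    by_cases hwx : w x = 0
    · refine ⟨fun _ => 1, ?_, ?_⟩
      · rw [pathMat_self, Matrix.one_mulVec]
        exact fun h => one_ne_zero (congrFun h ⟨0, hdj⟩)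
      · rw [hpath]
        simp [N, hwx]
    · refine ⟨x.2.1, ?_, ?_⟩
      · rw [pathMat_self, Matrix.one_mulVec]
        intro h
        exact hwx (by simp [w, h])
      · rw [hpath, ← Matrix.mulVec_mulVec]
        change Matrix.mulVec (N x) (w x) = 0
        simp [N, Matrix.sub_mulVec, Matrix.smul_mulVec, Matrix.vecMulVec_mulVec,
          dotProduct_comm (w x)]
  · refine (colKilled_subset_closure hi (lt_add_one i) hij hj hd).trans (closure_mono ?_)
    rintro A ⟨v, hv, hvj⟩
    obtain ⟨u, hu⟩ := Matrix.exists_dotProduct_eq_one hv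
    rw [pathMat_succ_left _ hij, ← Matrix.mulVec_mulVec] at hvj
    have hN : N (A, v, u) = arrow A i := by
      ext
      simp only [N, w, hu, hvj, Matrix.sub_apply, Matrix.vecMulVec_apply, Pi.zero_apply, one_smul,
        zero_mul, sub_zero]
    exact ⟨(A, v, u), by simp only [ψ, hN, setArrow_arrow]⟩

theorem isIrreducible_rankVariety {i j : ℕ} (hd : ∀ l, 1 ≤ l → l ≤ t → 0 < d l)
    (hJ : (i, j) ∈ J t d) : IsIrreducible (rankVariety K t d i j) := by
  obtain ⟨hi, hij, hj, h⟩ := hJ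
  simp only at hi hij hj h
  rcases le_total (d i) (d j) with hle | hle
  · have hr : genericRank d i j = d i := by
      refine genericRank_eq ⟨i, le_rfl, hij.le, rfl⟩ fun l h1 h2 => ?_
      rcases h1.eq_or_lt with rfl | h1
      · exact le_rfl
      rcases h2.eq_or_lt with rfl | h2
      · exact hle
      exact (le_max_left _ _).trans (h l h1 h2).le
    rw [rankVariety, hr, ← rowKilled_self hij.le]
    exact isIrreducible_rowKilled_self hi hij hj (hd i hi (by omega))
      fun l h1 h2 => (le_max_right _ _).trans_lt (h l h1 h2)
  · have hr : genericRank d i j = d j := by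
      refine genericRank_eq ⟨j, hij.le, le_rfl, rfl⟩ fun l h1 h2 => ?_
      rcases h1.eq_or_lt with rfl | h1
      · exact hle
      rcases h2.eq_or_lt with rfl | h2
      · exact le_rfl
      exact (le_max_right _ _).trans (h l h1 h2).le
    rw [rankVariety, hr, ← colKilled_self hij.le]
    exact isIrreducible_colKilled_self hi hij hj (hd j (by omega) hj)
      fun l h1 h2 => (le_max_left _ _).trans_lt (h l h1 h2)

end Irreducible

end TypeAQuiver

theorem corollary3p4 {K : Type*} [Field K] [IsAlgClosed K] (t : ℕ) (d : ℕ → ℕ)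
    (hd : ∀ l, 1 ≤ l → l ≤ t → 0 < d l) (i j : ℕ) (hi : 1 ≤ i) (hij : i < j) (hj : j ≤ t) :
    (IsIrreducible (TypeAQuiver.rankVariety K t d i j) ↔ (i, j) ∈ TypeAQuiver.J t d) ∧
    ((i, j) ∉ TypeAQuiver.J t d →
      ∃ Z₁ ∈ irreducibleComponents (TypeAQuiver.rankVariety K t d i j),
      ∃ Z₂ ∈ irreducibleComponents (TypeAQuiver.rankVariety K t d i j),
        ¬ Z₁ ⊆ Z₂ ∧ ¬ Z₂ ⊆ Z₁) := by
  have hred := TypeAQuiver.not_isIrreducible_rankVariety (K := K) hd hi hij hj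
  refine ⟨⟨fun h => ?_, TypeAQuiver.isIrreducible_rankVariety hd⟩, fun hJ => ?_⟩
  · by_contra hJ
    exact hred hJ h
  -- With `a = b = 0` no arrow is an identity: the zero representation shows that the variety is
  -- nonempty.
  · exact exists_not_subset_irreducibleComponents
      ⟨_, TypeAQuiver.stdRep_mem_rankVariety (a := 0) (b := 0) hi hij.le hj hd
        ⟨i, le_rfl, hij, .inr i.zero_le⟩⟩ (hred hJ)
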